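/- Let $n\ge 1$ and let $\mathbb H^n=\{\xi=(x,y,t)=(z,t): z=(x,y)\in\mathbb R^n\times\mathbb R^n,\ t\in\mathbb R\}$ be the Heisenberg group with group law $$\xi\circ\xi'=(x+x',\,y+y',\,t+t'+2\langle y,x'\rangle-2\langle x,y'\rangle),\qquad \xi^{-1}=-\xi,$$ Lebesgue (= Haar) measure $d\xi$, gauge $d(\xi)=(|z|^4+t^2)^{1/4}$ and homogeneous dimension $Q=2n+2$. For $p>1$, $s\in(0,1)$, $\alpha\in\mathbb R$ and a measurable $f:\mathbb H^n\to\mathbb R$ put $$[f]_{s,p,\alpha}=\left(\int_{\mathbb H^n}\int_{\mathbb H^n}\frac{|f(\xi)-f(\xi')|^p}{d(\xi^{-1}\circ\xi')^{Q+ps}\,|z-z'|^{(p-2)\alpha}}\,d\xi'\,d\xi\right)^{1/p}\in[0,\infty].$$ **Theorem.** Let $p>1$, $s\in(0,1)$, $\alpha\in\mathbb R$ with $0\le (p-2)\alpha<Q-2$, and let $\tau>1$, $0<a\le1$, $\gamma\in\mathbb R$, $q\ge1$ with $q>(1-a)\tau$ satisfy $$\frac1\tau+\frac{\gamma\left(1+(p-2)\frac{\alpha}{ps}\right)}{Q}=a\left(\frac1p-\frac{s\left(1+(p-2)\frac{\alpha}{ps}\right)}{Q}\right)+\frac{1-a}{q},\qquad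 0\le-\gamma\le as.$$ (i) If $\frac1\tau+\frac{\gamma\left(1+(p-2)\frac{\alpha}{ps}\right)}{Q}>\frac{2}{\tau Q}$, then there is a finite constant $C$, independent of $f$, such that $$\left(\int_{\mathbb H^n}d(\xi)^{\tau\gamma}\,|z|^{\tau\gamma(p-2)\frac{\alpha}{ps}}\,|f(\xi)|^\tau\,d\xi\right)^{1/\tau}\le C\,[f]_{s,p,\alpha}^{a}\,\|f\|_{L^q(\mathbb H^n)}^{1-a}\qquad\text{for all } f\in C_c^1(\mathbb H^n).$$ (ii) If $\frac1\tau+\frac{\gamma\left(1+(p-2)\frac{\alpha}{ps}\right)}{Q}<\frac{2}{\tau Q}$, then there is a finite constant $C$, independent of $f$, such that the same inequality holds for all $f\in C_c^1(\mathbb H^n\setminus\{(z,t):z=0\})$, i.e. for all $f \in C_c^1(\mathbb H^n)$ whose support does not meet the axis $\{z=0\}$. -/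

import Mathlib

open MeasureTheory
open scoped NNReal ENNReal

/-- The underlying space `ℝⁿ × ℝⁿ × ℝ` of the Heisenberg group `ℍⁿ`; a point is
`ξ = (x, y, t)`, with horizontal part `z = (x, y)`. Its `volume` is the Lebesgue measure on
`ℝ^(2n+1)`, which is the Haar measure of the group. -/
abbrev Heisenberg (n : ℕ) : Type :=
  EuclideanSpace ℝ (Fin n) × EuclideanSpace ℝ (Fin n) × ℝ

namespace Heisenberg

variable {n : ℕ}

/-- The group law
`ξ ∘ ξ' = (x + x', y + y', t + t' + 2⟨y, x'⟩ - 2⟨x, y'⟩)`. -/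
noncomputable def mul (ξ η : Heisenberg n) : Heisenberg n :=
  (ξ.1 + η.1, ξ.2.1 + η.2.1,
    ξ.2.2 + η.2.2 + 2 * inner ℝ ξ.2.1 η.1 - 2 * inner ℝ ξ.1 η.2.1)

/-- The inverse for the group law, `ξ⁻¹ = -ξ`. -/
def inv (ξ : Heisenberg n) : Heisenberg n := -ξ

theorem mul_assoc (ξ η ζ : Heisenberg n) : mul (mul ξ η) ζ = mul ξ (mul η ζ) := by
  simp only [mul, Prod.mk.injEq, inner_add_left, inner_add_right]
  refine ⟨by abel, by abel, by ring⟩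

theorem mul_zero (ξ : Heisenberg n) : mul ξ 0 = ξ := by
  simp [mul]

theorem zero_mul (ξ : Heisenberg n) : mul 0 ξ = ξ := by
  simp [mul]

theorem inv_mul (ξ : Heisenberg n) : mul (inv ξ) ξ = 0 := by
  ext <;> simp [mul, inv, real_inner_comm]

/-- The Euclidean length `|z| = (|x|² + |y|²)^(1/2)` of the horizontal part of `ξ = (z, t)`. -/
noncomputable def horNorm (ξ : Heisenberg n) : ℝ := Real.sqrt (‖ξ.1‖ ^ 2 + ‖ξ.2.1‖ ^ 2)

/-- The Koranyi-Folland gauge `d(ξ) = (|z|⁴ + t²)^(1/4)`. -/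
noncomputable def gauge (ξ : Heisenberg n) : ℝ := (horNorm ξ ^ 4 + ξ.2.2 ^ 2) ^ (1 / 4 : ℝ)

/-- The homogeneous dimension `Q = 2n + 2`. -/
def homDim (n : ℕ) : ℝ := 2 * n + 2

/-- The axis `{ξ = (z, t) : z = 0}`. -/
def axis (n : ℕ) : Set (Heisenberg n) := {ξ | ξ.1 = 0 ∧ ξ.2.1 = 0}

/-- The fractional seminorm `[f]_{s,p,α}`, with values in `[0, ∞]`:
the `p`-th root of
`∫∫ |f(ξ) - f(ξ')|^p / (d(ξ⁻¹ ∘ ξ')^(Q + p s) |z - z'|^((p - 2) α)) dξ' dξ`. -/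
noncomputable def fracSeminorm (s p α : ℝ) (f : Heisenberg n → ℝ) : ℝ≥0∞ :=
  (∫⁻ ξ : Heisenberg n, ∫⁻ η : Heisenberg n,
    ‖f ξ - f η‖ₑ ^ p /
      (ENNReal.ofReal (gauge (mul (inv ξ) η)) ^ (homDim n + p * s) *
        ENNReal.ofReal (horNorm (ξ - η)) ^ ((p - 2) * α))) ^ (1 / p)

/-- The weighted norm
`(∫ d(ξ)^(τ γ) |z|^(τ γ (p - 2) α / (p s)) |f(ξ)|^τ dξ)^(1/τ)`, with values in `[0, ∞]`. -/
noncomputable def weightedNorm (s p α τ γ : ℝ) (f : Heisenberg n → ℝ) : ℝ≥0∞ :=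
  (∫⁻ ξ : Heisenberg n,
    ENNReal.ofReal (gauge ξ) ^ (τ * γ) *
      ENNReal.ofReal (horNorm ξ) ^ (τ * γ * (p - 2) * (α / (p * s))) *
        ‖f ξ‖ₑ ^ τ) ^ (1 / τ)

end Heisenberg

/-!
The proof is a pointwise estimate by the inner integral of the seminorm, followed by one absorption;
neither a Poincaré inequality nor a decomposition into dyadic pieces is needed.

Write `β = (p - 2) α`, `θ = s + β / p`, `Q = 2n + 2` and `M = |f(ξ)|`. Since `γ ≤ 0` and
`d(ξ) ≥ |z|`, the weight is at most `|z|^(-b)` with `b = -τ γ (1 + β / (p s)) ≥ 0`, so it is enough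
to bound `J = ∫ |z|^(-b) |f|^τ` (`weightedNorm_le`). The two cases of the theorem are `b < 2n` and
`b > 2n`; in both `J` is finite, by local integrability of the weight or because `f` vanishes near
the axis. Let `Y(ξ)` be the inner integral of the seminorm (`energyDensity`).

For a set `S` near `ξ`, one of `|f(ξ) - f(η)| ≥ M / 2` and `|f(η)| ≥ M / 2` holds for `η` in at least
half of `S`, because every `η` satisfies one of them.
So `M` is controlled by `Y(ξ)` or by the `L^τ` average of `f` over `S` (`energy_or_average`). This
is used for two families of sets.

* For `S = shellBox Λ ξ`, of size comparable to `|z|` and located at `|z'| ≈ Λ |z|`: by double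
  counting, the averages over these sets contribute to `J` at most a multiple of `Λ^(b - 2n) J`
  (`lintegral_shellBox_average_le`). As `b ≠ 2n`, a suitable `Λ`, large if `b < 2n` and small if
  `b > 2n`, makes this at most `J / 2`, which is absorbed. Where the average does not control `M`,
  one has `M^p ≤ K |z|^(p θ) Y(ξ)`.
* For `S = box ξ r` with `r ≤ |z|`: either `M^p ≤ K r^(p θ) Y(ξ)` or `M^τ r^Q ≤ L |z|^b J`. Taking
  `r` with `K r^(p θ) Y(ξ) = M^p / 2` rules out the first and bounds `|z|^(-b) M^τ` by `J^(1 - e)`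
  times powers of `Y(ξ)` and `M` (`rpow_le_of_scales`, `exists_pointwise_bound`). Such an `r` is at
  most `|z|` by the estimate on `S = shellBox Λ ξ`. Here `e = Q / (Q + a τ θ - b) ∈ (0, 1]`.

Integrating, Hölder's inequality, whose exponents fit by the balance condition, gives
`J ≤ C J^(1 - e) (∫ Y)^(a τ e / p) (∫ |f|^q)^((1 - a) τ e / q) + J / 2`, and hence the theorem.
-/

open MeasureTheory
open scoped NNReal ENNReal

namespace Heisenberg

variable {n : ℕ}

/-! ### The horizontal plane and its dilations -/

/-- The space `ℝⁿ × ℝⁿ` of horizontal parts `z = (x, y)`. Its norm as a product space is the maximum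
norm; the Euclidean length is `planeNorm`. -/
abbrev Plane (n : ℕ) : Type := EuclideanSpace ℝ (Fin n) × EuclideanSpace ℝ (Fin n)

/-- The Euclidean length `|z|` of `z = (x, y)`, so that `horNorm ξ = planeNorm (ξ.1, ξ.2.1)`. -/
noncomputable def planeNorm (z : Plane n) : ℝ := Real.sqrt (‖z.1‖ ^ 2 + ‖z.2‖ ^ 2)

theorem planeNorm_eq (z : Plane n) : planeNorm z = ‖WithLp.toLp 2 z‖ := by
  rw [WithLp.prod_norm_eq_of_L2]; rfl

theorem planeNorm_nonneg (z : Plane n) : 0 ≤ planeNorm z := Real.sqrt_nonneg _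

theorem planeNorm_add_le (z w : Plane n) : planeNorm (z + w) ≤ planeNorm z + planeNorm w := by
  simp only [planeNorm_eq, WithLp.toLp_add]; exact norm_add_le _ _

theorem planeNorm_neg (z : Plane n) : planeNorm (-z) = planeNorm z := by
  simp [planeNorm]

theorem planeNorm_smul {r : ℝ} (hr : 0 ≤ r) (z : Plane n) :
    planeNorm (r • z) = r * planeNorm z := by
  simp only [planeNorm_eq, WithLp.toLp_smul, norm_smul, Real.norm_of_nonneg hr]

theorem planeNorm_eq_zero {z : Plane n} : planeNorm z = 0 ↔ z = 0 := by
  rw [planeNorm_eq, norm_eq_zero]; simp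

@[fun_prop]
theorem continuous_planeNorm : Continuous (planeNorm (n := n)) := by
  unfold planeNorm; fun_prop

theorem norm_le_planeNorm (z : Plane n) : ‖z‖ ≤ planeNorm z := by
  refine max_le ?_ ?_ <;> refine Real.le_sqrt_of_sq_le ?_ <;>
    nlinarith [sq_nonneg ‖z.1‖, sq_nonneg ‖z.2‖]

theorem continuous_horNorm : Continuous (horNorm (n := n)) := by
  unfold horNorm; fun_prop

theorem horNorm_nonneg (ξ : Heisenberg n) : 0 ≤ horNorm ξ := Real.sqrt_nonneg _

theorem horNorm_eq (ξ : Heisenberg n) : horNorm ξ = planeNorm (ξ.1, ξ.2.1) := rfl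

theorem horNorm_add_le (ξ η : Heisenberg n) : horNorm (ξ + η) ≤ horNorm ξ + horNorm η :=
  planeNorm_add_le (ξ.1, ξ.2.1) (η.1, η.2.1)

theorem horNorm_sub_comm (ξ η : Heisenberg n) : horNorm (ξ - η) = horNorm (η - ξ) := by
  rw [← neg_sub, horNorm_eq, ← planeNorm_neg]; simp [horNorm_eq]

theorem finrank_plane : Module.finrank ℝ (Plane n) = 2 * n := by
  simp [two_mul]

instance : (volume : Measure (Plane n)).IsAddHaarMeasure :=
  inferInstanceAs
    ((volume : Measure (EuclideanSpace ℝ (Fin n))).prod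
      (volume : Measure (EuclideanSpace ℝ (Fin n)))).IsAddHaarMeasure

theorem volume_dilate (S : Set (Plane n)) {r : ℝ} (hr : 0 < r) :
    volume {z | r⁻¹ • z ∈ S} = ENNReal.ofReal (r ^ (2 * n)) * volume S := by
  have h := Measure.addHaar_preimage_smul (volume : Measure (Plane n)) (inv_ne_zero hr.ne') S
  rw [finrank_plane, inv_pow, inv_inv, abs_of_pos (by positivity)] at h
  exact h

/-- The open shell `r < |z| < 2 r`; it is empty for `r ≤ 0`. -/
def shell (n : ℕ) (r : ℝ) : Set (Plane n) := {z | r < planeNorm z ∧ planeNorm z < 2 * r}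

theorem isOpen_shell (r : ℝ) : IsOpen (shell n r) :=
  (isOpen_lt continuous_const continuous_planeNorm).inter
    (isOpen_lt continuous_planeNorm continuous_const)

theorem volume_shell {r : ℝ} (hr : 0 < r) :
    volume (shell n r) = ENNReal.ofReal (r ^ (2 * n)) * volume (shell n 1) := by
  rw [← volume_dilate _ hr]
  congr 1
  ext z
  simp only [shell, Set.mem_ofPred_eq, planeNorm_smul (inv_nonneg.2 hr.le)]
  rw [inv_mul_eq_div, lt_div_iff₀ hr, div_lt_iff₀ hr, one_mul, mul_one]

theorem volume_planeBall (z₀ : Plane n) {r : ℝ} (hr : 0 < r) :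
    volume {z : Plane n | planeNorm (z - z₀) < r}
      = ENNReal.ofReal (r ^ (2 * n)) * volume {z : Plane n | planeNorm z < 1} := by
  have h := measure_preimage_add_right (volume : Measure (Plane n)) (-z₀) {z | planeNorm z < r}
  simp only [← sub_eq_add_neg] at h
  rw [← volume_dilate _ hr]
  refine h.trans (congrArg _ ?_)
  ext z
  simp only [Set.mem_ofPred_eq, planeNorm_smul (inv_nonneg.2 hr.le)]
  rw [inv_mul_eq_div, div_lt_iff₀ hr, one_mul]

theorem volume_planeNorm_lt_ne_top (r : ℝ) : volume {z : Plane n | planeNorm z < r} ≠ ∞ := by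
  refine ((measure_mono (t := Metric.closedBall 0 r) fun z hz => ?_).trans_lt
    measure_closedBall_lt_top).ne
  simpa using (norm_le_planeNorm z).trans (le_of_lt hz)

theorem volume_planeBall_pos : 0 < volume {z : Plane n | planeNorm z < 1} :=
  (isOpen_lt continuous_planeNorm continuous_const).measure_pos _ ⟨0, by simp [planeNorm]⟩

theorem volume_shell_pos (hn : 1 ≤ n) : 0 < volume (shell n 1) := by
  refine (isOpen_shell 1).measure_pos _ ⟨(EuclideanSpace.single ⟨0, hn⟩ (3 / 2), 0), ?_⟩
  simp only [shell, planeNorm, Set.mem_ofPred_eq, PiLp.norm_single, norm_zero]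
  norm_num

theorem volume_shell_ne_top : volume (shell n 1) ≠ ∞ :=
  measure_ne_top_of_subset (fun _ hz => hz.2) (volume_planeNorm_lt_ne_top (2 * 1))

/-! ### Integration over slabs -/

/-- Fubini for a function of `z` on a slab `|t - c(z)| < ρ(z)`: the `t`-integral contributes the
length `2 ρ(z)`. -/
theorem lintegral_slab {h : Plane n → ℝ≥0∞} (hh : Measurable h) {c ρ : Plane n → ℝ}
    (hc : Measurable c) (hρ : Measurable ρ) :
    ∫⁻ ξ : Heisenberg n, {ξ : Heisenberg n | |ξ.2.2 - c (ξ.1, ξ.2.1)| < ρ (ξ.1, ξ.2.1)}.indicator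
        (fun ξ => h (ξ.1, ξ.2.1)) ξ
      = ∫⁻ z, h z * ENNReal.ofReal (2 * ρ z) := by
  have hS : MeasurableSet {ξ : Heisenberg n | |ξ.2.2 - c (ξ.1, ξ.2.1)| < ρ (ξ.1, ξ.2.1)} := by
    have h1 : Measurable fun ξ : Heisenberg n => |ξ.2.2 - c (ξ.1, ξ.2.1)| := by fun_prop
    exact measurableSet_lt h1 (by fun_prop)
  have hm := (show Measurable fun ξ : Heisenberg n => h (ξ.1, ξ.2.1) by fun_prop).indicator hS
  rw [Measure.volume_eq_prod, lintegral_prod _ hm.aemeasurable,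
    Measure.volume_eq_prod (EuclideanSpace ℝ (Fin n)) (EuclideanSpace ℝ (Fin n)),
    lintegral_prod _ (by fun_prop)]
  refine lintegral_congr fun x => ?_
  refine (lintegral_prod _ (hm.comp (measurable_prodMk_left (x := x))).aemeasurable).trans ?_
  refine lintegral_congr fun y => ?_
  have h1 : ∀ t : ℝ, {ξ : Heisenberg n | |ξ.2.2 - c (ξ.1, ξ.2.1)| < ρ (ξ.1, ξ.2.1)}.indicator
      (fun ξ => h (ξ.1, ξ.2.1)) (x, y, t)
      = (Metric.ball (c (x, y)) (ρ (x, y))).indicator (fun _ => h (x, y)) t := fun t => by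
    simp [Set.indicator, Real.dist_eq]
  simp only [Function.comp_apply, h1]
  rw [lintegral_indicator_const Metric.isOpen_ball.measurableSet, Real.volume_ball]

theorem volume_slab {S : Set (Plane n)} (hS : MeasurableSet S) {c : Plane n → ℝ}
    (hc : Measurable c) (ρ : ℝ) :
    volume {ξ : Heisenberg n | (ξ.1, ξ.2.1) ∈ S ∧ |ξ.2.2 - c (ξ.1, ξ.2.1)| < ρ}
      = volume S * ENNReal.ofReal (2 * ρ) := by
  have h := lintegral_slab (n := n) (h := S.indicator 1) (measurable_one.indicator hS) hc
    (measurable_const (a := ρ))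
  rw [lintegral_mul_const _ (measurable_one.indicator hS), lintegral_indicator_one hS] at h
  rw [← h, ← lintegral_indicator_one]
  · refine lintegral_congr fun ξ => ?_
    by_cases h1 : (ξ.1, ξ.2.1) ∈ S <;> simp [Set.indicator, h1]
  · have h1 : Measurable fun ξ : Heisenberg n => |ξ.2.2 - c (ξ.1, ξ.2.1)| := by fun_prop
    exact (hS.preimage (by fun_prop : Measurable fun ξ : Heisenberg n => (ξ.1, ξ.2.1))).inter
      (measurableSet_lt h1 measurable_const)

/-! ### The energy density and a pigeonhole alternative -/

/-- The `t`-coordinate of `ξ⁻¹ ∘ η`. For fixed horizontal parts it is a translation in either of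
the two `t`-coordinates, so that sets cut out by a bound on it are slabs. -/
noncomputable def vert (ξ η : Heisenberg n) : ℝ := (mul (inv ξ) η).2.2

theorem vert_eq_sub (ξ η : Heisenberg n) :
    vert ξ η = η.2.2 - (ξ.2.2 + 2 * inner ℝ ξ.2.1 η.1 - 2 * inner ℝ ξ.1 η.2.1) := by
  simp only [vert, mul, inv, Prod.fst_neg, Prod.snd_neg, inner_neg_left]; ring

theorem abs_vert_eq (ξ η : Heisenberg n) :
    |vert ξ η| = |ξ.2.2 - (η.2.2 - 2 * inner ℝ ξ.2.1 η.1 + 2 * inner ℝ ξ.1 η.2.1)| := by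
  rw [vert_eq_sub, abs_sub_comm]; congr 1; ring

theorem horNorm_inv_mul (ξ η : Heisenberg n) : horNorm (mul (inv ξ) η) = horNorm (ξ - η) := by
  rw [horNorm_sub_comm]
  simp [horNorm, mul, inv, neg_add_eq_sub]

theorem horNorm_le_gauge (ξ : Heisenberg n) : horNorm ξ ≤ gauge ξ := by
  calc horNorm ξ = (horNorm ξ ^ 4) ^ (1 / 4 : ℝ) := by
        have := Real.pow_rpow_inv_natCast (horNorm_nonneg ξ) (n := 4) (by norm_num)
        simpa using this.symm
    _ ≤ gauge ξ := by
        have := horNorm_nonneg ξ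
        exact Real.rpow_le_rpow (by positivity) (by nlinarith [sq_nonneg ξ.2.2]) (by norm_num)

theorem gauge_inv_mul_le {ξ η : Heisenberg n} {R : ℝ} (hR : 0 ≤ R)
    (h₁ : horNorm (ξ - η) ≤ R) (h₂ : |vert ξ η| ≤ R ^ 2) : gauge (mul (inv ξ) η) ≤ 2 * R := by
  have h3 : horNorm (ξ - η) ^ 4 ≤ R ^ 4 := pow_le_pow_left₀ (horNorm_nonneg _) h₁ 4
  have h4 : vert ξ η ^ 2 ≤ (R ^ 2) ^ 2 := sq_le_sq' (neg_le_of_abs_le h₂) (le_of_abs_le h₂)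
  have h5 := Real.pow_rpow_inv_natCast (show 0 ≤ 2 * R by positivity) (n := 4) (by norm_num)
  calc gauge (mul (inv ξ) η) ≤ ((2 * R) ^ 4) ^ (1 / 4 : ℝ) := by
        rw [gauge, horNorm_inv_mul]
        refine Real.rpow_le_rpow (by positivity) ?_ (by norm_num)
        change _ + vert ξ η ^ 2 ≤ _
        nlinarith [pow_nonneg hR 4]
    _ = 2 * R := by simpa using h5

/-- The inner integral of the seminorm, as a function of `ξ`, with `β` in place of `(p - 2) α`:
`∫ |f(ξ) - f(η)|^p / (d(ξ⁻¹ ∘ η)^(Q + p s) |z - z'|^β) dη`. -/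
noncomputable def energyDensity (s p β : ℝ) (f : Heisenberg n → ℝ) (ξ : Heisenberg n) : ℝ≥0∞ :=
  ∫⁻ η : Heisenberg n, ‖f ξ - f η‖ₑ ^ p /
      (ENNReal.ofReal (gauge (mul (inv ξ) η)) ^ (homDim n + p * s) *
        ENNReal.ofReal (horNorm (ξ - η)) ^ β)

theorem measurable_kernel {s p β : ℝ} {f : Heisenberg n → ℝ} (hf : Measurable f) :
    Measurable fun x : Heisenberg n × Heisenberg n => ‖f x.1 - f x.2‖ₑ ^ p /
      (ENNReal.ofReal (gauge (mul (inv x.1) x.2)) ^ (homDim n + p * s) *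
        ENNReal.ofReal (horNorm (x.1 - x.2)) ^ β) := by
  have h1 := (continuous_horNorm (n := n)).measurable
  have h2 : Measurable fun x : Heisenberg n × Heisenberg n => gauge (mul (inv x.1) x.2) := by
    have : Continuous fun x : Heisenberg n × Heisenberg n => mul (inv x.1) x.2 := by
      unfold mul inv; fun_prop
    have h3 := h1.comp this.measurable
    have h4 := this.measurable.snd.snd
    exact ((h3.pow_const 4).add (h4.pow_const 2)).pow_const _
  fun_prop

theorem measurable_energyDensity {s p β : ℝ} {f : Heisenberg n → ℝ} (hf : Measurable f) :
    Measurable (energyDensity s p β f) :=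
  (measurable_kernel hf).lintegral_prod_right'

/-- At distance at most `R` the kernel of the energy density is at least
`(2 R)^(-(Q + p s + β))`. -/
theorem setLIntegral_le_energyDensity {s p β : ℝ} (hp : 0 < p) (hs : 0 < s) (hβ : 0 ≤ β)
    (f : Heisenberg n → ℝ) {ξ : Heisenberg n} {S : Set (Heisenberg n)} (hS : MeasurableSet S)
    {R : ℝ} (hR : 0 < R) (h₁ : ∀ η ∈ S, horNorm (ξ - η) ≤ R) (h₂ : ∀ η ∈ S, |vert ξ η| ≤ R ^ 2) :
    ∫⁻ η in S, ‖f ξ - f η‖ₑ ^ p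
      ≤ ENNReal.ofReal (2 * R) ^ (homDim n + p * s + β) * energyDensity s p β f ξ := by
  have hQ : 0 ≤ homDim n + p * s := by unfold homDim; positivity
  have hR0 : ENNReal.ofReal (2 * R) ≠ 0 := by simpa using hR
  have hK0 : ENNReal.ofReal (2 * R) ^ (homDim n + p * s + β) ≠ 0 :=
    (ENNReal.rpow_pos (pos_iff_ne_zero.2 hR0) ENNReal.ofReal_ne_top).ne'
  have hKt : ENNReal.ofReal (2 * R) ^ (homDim n + p * s + β) ≠ ∞ :=
    ENNReal.rpow_ne_top_of_nonneg (by positivity) ENNReal.ofReal_ne_top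
  rw [energyDensity, ← lintegral_const_mul' _ _ hKt]
  refine (setLIntegral_mono' hS fun η hη => ?_).trans (setLIntegral_le_lintegral S _)
  calc ‖f ξ - f η‖ₑ ^ p = ENNReal.ofReal (2 * R) ^ (homDim n + p * s + β) *
        (‖f ξ - f η‖ₑ ^ p / ENNReal.ofReal (2 * R) ^ (homDim n + p * s + β)) :=
        (ENNReal.mul_div_cancel hK0 hKt).symm
    _ ≤ _ := by
        gcongr
        rw [ENNReal.rpow_add _ _ hR0 ENNReal.ofReal_ne_top]
        gcongr
        · exact gauge_inv_mul_le hR.le (h₁ η hη) (h₂ η hη)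
        · exact (h₁ η hη).trans (by linarith)

/-- One of `|f ξ - f η|` and `|f η|` is at least `|f ξ| / 2` on at least half of `S`, so `|f ξ|` is
controlled by the energy density at `ξ` or by the `L^τ` average of `f` over `S`. -/
theorem energy_or_average {s p β τ : ℝ} (hp : 0 < p) (hs : 0 < s) (hβ : 0 ≤ β) (hτ : 0 < τ)
    {f : Heisenberg n → ℝ} (hf : Measurable f) {ξ : Heisenberg n} {S : Set (Heisenberg n)}
    (hS : MeasurableSet S) {R : ℝ} (hR : 0 < R) (h₁ : ∀ η ∈ S, horNorm (ξ - η) ≤ R)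
    (h₂ : ∀ η ∈ S, |vert ξ η| ≤ R ^ 2) :
    ‖f ξ‖ₑ ^ p * volume S ≤ 2 ^ (p + 1) *
        (ENNReal.ofReal (2 * R) ^ (homDim n + p * s + β) * energyDensity s p β f ξ) ∨
    ‖f ξ‖ₑ ^ τ * volume S ≤ 2 ^ (τ + 1) * ∫⁻ η in S, ‖f η‖ₑ ^ τ := by
  set M := ‖f ξ‖ₑ with hM
  -- Chebyshev's inequality for a function that is at least `|f ξ| / 2` on half of `S`
  have cheb : ∀ (r : ℝ) (_ : 0 < r) (g : Heisenberg n → ℝ) (_ : Measurable g),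
      volume S ≤ 2 * volume.restrict S {η | (M / 2) ^ r ≤ ‖g η‖ₑ ^ r} →
      M ^ r * volume S ≤ 2 ^ (r + 1) * ∫⁻ η in S, ‖g η‖ₑ ^ r := by
    intro r hr g hg h
    calc M ^ r * volume S
        ≤ M ^ r * (2 * volume.restrict S {η | (M / 2) ^ r ≤ ‖g η‖ₑ ^ r}) := by gcongr
      _ = 2 ^ (r + 1) * ((M / 2) ^ r * volume.restrict S {η | (M / 2) ^ r ≤ ‖g η‖ₑ ^ r}) := by
          have h2 : M ^ r = 2 ^ r * (M / 2) ^ r := by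
            rw [← ENNReal.mul_rpow_of_nonneg _ _ hr.le,
              ENNReal.mul_div_cancel two_ne_zero ENNReal.ofNat_ne_top]
          rw [h2, ENNReal.rpow_add _ _ two_ne_zero ENNReal.ofNat_ne_top, ENNReal.rpow_one]
          ring
      _ ≤ _ := by
          gcongr
          exact mul_meas_ge_le_lintegral (by fun_prop) _
  have cover : volume S ≤ volume.restrict S {η | (M / 2) ^ p ≤ ‖f ξ - f η‖ₑ ^ p}
      + volume.restrict S {η | (M / 2) ^ τ ≤ ‖f η‖ₑ ^ τ} := by
    rw [← Measure.restrict_apply_univ S]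
    refine (measure_mono fun η _ => ?_).trans (measure_union_le _ _)
    by_contra hc
    simp only [Set.mem_union, Set.mem_ofPred_eq, not_or, not_le] at hc
    have h3 := (ENNReal.rpow_lt_rpow_iff hp).1 hc.1
    have h4 := (ENNReal.rpow_lt_rpow_iff hτ).1 hc.2
    have h5 : M ≤ ‖f ξ - f η‖ₑ + ‖f η‖ₑ := by
      simpa using enorm_add_le (f ξ - f η) (f η)
    exact absurd (h5.trans_lt (ENNReal.add_lt_add h3 h4)) (by simp)
  rcases le_total (volume.restrict S {η | (M / 2) ^ p ≤ ‖f ξ - f η‖ₑ ^ p})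
      (volume.restrict S {η | (M / 2) ^ τ ≤ ‖f η‖ₑ ^ τ}) with h | h
  · right
    refine cheb τ hτ f hf (cover.trans ?_)
    rw [two_mul]; gcongr
  · left
    refine (cheb p hp (fun η => f ξ - f η) (by fun_prop) (cover.trans ?_)).trans ?_
    · rw [two_mul]; gcongr
    · gcongr
      exact setLIntegral_le_energyDensity hp hs hβ f hS hR h₁ h₂

/-! ### Boxes and shell boxes -/

theorem exists_volume_shell (hn : 1 ≤ n) :
    ∃ c : ℝ, 0 < c ∧ ∀ r : ℝ, 0 < r → volume (shell n r) = ENNReal.ofReal (r ^ (2 * n) * c) := by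
  refine ⟨(volume (shell n 1)).toReal,
    ENNReal.toReal_pos (volume_shell_pos hn).ne' volume_shell_ne_top, fun r hr => ?_⟩
  rw [volume_shell hr, ENNReal.ofReal_mul (by positivity),
    ENNReal.ofReal_toReal volume_shell_ne_top]

theorem exists_volume_planeBall :
    ∃ c : ℝ, 0 < c ∧ ∀ (z₀ : Plane n) (r : ℝ), 0 < r →
      volume {z : Plane n | planeNorm (z - z₀) < r} = ENNReal.ofReal (r ^ (2 * n) * c) := by
  refine ⟨(volume {z : Plane n | planeNorm z < 1}).toReal,
    ENNReal.toReal_pos volume_planeBall_pos.ne' (volume_planeNorm_lt_ne_top 1), fun z₀ r hr => ?_⟩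
  rw [volume_planeBall z₀ hr, ENNReal.ofReal_mul (by positivity),
    ENNReal.ofReal_toReal (volume_planeNorm_lt_ne_top 1)]

/-- The points `η` with `|z' - z| < r` whose vertical displacement from `ξ` is less than `r²`: a
left translate by `ξ` of a set of homogeneous size `r`. -/
def box (ξ : Heisenberg n) (r : ℝ) : Set (Heisenberg n) :=
  {η | (η.1, η.2.1) ∈ {z : Plane n | planeNorm (z - (ξ.1, ξ.2.1)) < r} ∧ |vert ξ η| < r ^ 2}

/-- The points `η` with `Λ |z| < |z'| < 2 Λ |z|` whose vertical displacement from `ξ` is less than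
`|z|²`. Large `Λ` moves away from the axis, small `Λ` towards it. -/
def shellBox (Λ : ℝ) (ξ : Heisenberg n) : Set (Heisenberg n) :=
  {η | (η.1, η.2.1) ∈ shell n (Λ * horNorm ξ) ∧ |vert ξ η| < horNorm ξ ^ 2}

theorem measurable_vert :
    Measurable fun x : Heisenberg n × Heisenberg n => vert x.1 x.2 := by
  have : Continuous fun x : Heisenberg n × Heisenberg n => vert x.1 x.2 := by
    unfold vert mul inv; fun_prop
  exact this.measurable

theorem measurableSet_box (ξ : Heisenberg n) (r : ℝ) : MeasurableSet (box ξ r) := by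
  have h1 : Measurable fun η : Heisenberg n => |vert ξ η| :=
    (measurable_vert.comp measurable_prodMk_left).norm
  have h2 : Continuous fun η : Heisenberg n => planeNorm ((η.1, η.2.1) - (ξ.1, ξ.2.1)) := by
    fun_prop
  have h3 := measurableSet_lt h2.measurable (measurable_const (a := r))
  have h4 := measurableSet_lt h1 (measurable_const (a := r ^ 2))
  exact h3.inter h4

theorem measurableSet_mem_shellBox (Λ : ℝ) :
    MeasurableSet {x : Heisenberg n × Heisenberg n | x.2 ∈ shellBox Λ x.1} := by
  have h0 := (continuous_horNorm (n := n)).measurable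
  have h1 : Measurable fun x : Heisenberg n × Heisenberg n => horNorm x.1 := h0.comp measurable_fst
  have h2 : Measurable fun x : Heisenberg n × Heisenberg n => horNorm x.2 := h0.comp measurable_snd
  have h3 : Measurable fun x : Heisenberg n × Heisenberg n => |vert x.1 x.2| :=
    measurable_vert.norm
  have h4 := measurableSet_lt (h1.const_mul Λ) h2
  have h5 := measurableSet_lt h2 ((h1.const_mul Λ).const_mul 2)
  have h6 := measurableSet_lt h3 (h1.pow_const 2)
  exact (h4.inter h5).inter h6

theorem measurableSet_shellBox (Λ : ℝ) (ξ : Heisenberg n) : MeasurableSet (shellBox Λ ξ) := by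
  have h : Prod.mk ξ ⁻¹' {x : Heisenberg n × Heisenberg n | x.2 ∈ shellBox Λ x.1}
      = shellBox Λ ξ := by
    ext; rfl
  exact h ▸ measurable_prodMk_left (measurableSet_mem_shellBox Λ)

theorem measurableSet_setOf_mem_shellBox (Λ : ℝ) (η : Heisenberg n) :
    MeasurableSet {ξ | η ∈ shellBox Λ ξ} := by
  have h : (fun ξ => (ξ, η)) ⁻¹' {x : Heisenberg n × Heisenberg n | x.2 ∈ shellBox Λ x.1}
      = {ξ | η ∈ shellBox Λ ξ} := by
    ext; rfl
  exact h ▸ measurable_prodMk_right (measurableSet_mem_shellBox Λ)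

theorem volume_vert_lt {S : Set (Plane n)} (hS : MeasurableSet S) (ξ : Heisenberg n) (r : ℝ) :
    volume {η : Heisenberg n | (η.1, η.2.1) ∈ S ∧ |vert ξ η| < r}
      = volume S * ENNReal.ofReal (2 * r) := by
  rw [← volume_slab hS (c := fun z => ξ.2.2 + 2 * inner ℝ ξ.2.1 z.1 - 2 * inner ℝ ξ.1 z.2)
    (by fun_prop) r]
  simp only [vert_eq_sub]

theorem exists_volume_box : ∃ c : ℝ, 0 < c ∧ ∀ (ξ : Heisenberg n) (r : ℝ), 0 < r →
    volume (box ξ r) = ENNReal.ofReal (c * r ^ homDim n) := by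
  obtain ⟨c, hc, h⟩ := exists_volume_planeBall (n := n)
  refine ⟨c * 2, by positivity, fun ξ r hr => ?_⟩
  have hcont : Continuous fun z : Plane n => planeNorm (z - (ξ.1, ξ.2.1)) := by fun_prop
  rw [box, volume_vert_lt (isOpen_lt hcont continuous_const).measurableSet, h _ _ hr,
    ← ENNReal.ofReal_mul (by positivity)]
  congr 1
  have : r ^ homDim n = r ^ (2 * n) * r ^ 2 := by
    rw [← pow_add, ← Real.rpow_natCast, homDim]; push_cast; rfl
  rw [this]; ring

theorem exists_volume_shellBox (hn : 1 ≤ n) : ∃ c : ℝ, 0 < c ∧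
    (∀ r : ℝ, 0 < r → volume (shell n r) = ENNReal.ofReal (r ^ (2 * n) * c)) ∧
    ∀ (Λ : ℝ) (ξ : Heisenberg n), 0 < Λ → 0 < horNorm ξ →
    volume (shellBox Λ ξ)
      = ENNReal.ofReal ((Λ * horNorm ξ) ^ (2 * n) * c * (2 * horNorm ξ ^ 2)) := by
  obtain ⟨c, hc, h⟩ := exists_volume_shell hn
  refine ⟨c, hc, h, fun Λ ξ hΛ hξ => ?_⟩
  rw [shellBox, volume_vert_lt (isOpen_shell _).measurableSet, h _ (by positivity),
    ← ENNReal.ofReal_mul (by positivity)]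

theorem horNorm_sub_le_of_mem_shellBox {Λ : ℝ} {ξ η : Heisenberg n} (h : η ∈ shellBox Λ ξ) :
    horNorm (ξ - η) ≤ (1 + 2 * Λ) * horNorm ξ := by
  have h1 := horNorm_add_le ξ (-η)
  have h2 : horNorm (-η) = horNorm η := by simp [horNorm]
  have h3 : horNorm η < 2 * (Λ * horNorm ξ) := h.1.2
  rw [← sub_eq_add_neg] at h1
  linarith

theorem horNorm_sub_le_of_mem_box {r : ℝ} {ξ η : Heisenberg n} (h : η ∈ box ξ r) :
    horNorm (ξ - η) ≤ r := by
  rw [horNorm_sub_comm]; exact le_of_lt h.1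

theorem horNorm_le_of_mem_box {r : ℝ} {ξ η : Heisenberg n} (h : η ∈ box ξ r)
    (hr : r ≤ horNorm ξ) : horNorm η ≤ 2 * horNorm ξ := by
  have h1 := horNorm_add_le ξ (η - ξ)
  have h2 := horNorm_sub_le_of_mem_box h
  rw [horNorm_sub_comm] at h2
  rw [add_sub_cancel] at h1
  linarith

/-! ### Double counting over shell boxes -/

/-- For fixed `η`, the points `ξ` with `η ∈ shellBox Λ ξ` form a slab over the shell of radius
`|z'| / (2 Λ)`, and the height `2 |z|²` of the slab cancels against the volume of `shellBox Λ ξ`. -/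
theorem lintegral_mem_shellBox_le {b c Λ : ℝ} (hb : 0 ≤ b) (hc : 0 < c) (hΛ : 0 < Λ)
    (hvol : ∀ r : ℝ, 0 < r → volume (shell n r) = ENNReal.ofReal (r ^ (2 * n) * c))
    (η : Heisenberg n) :
    ∫⁻ ξ : Heisenberg n, {ξ | η ∈ shellBox Λ ξ}.indicator
      (fun ξ => ENNReal.ofReal (horNorm ξ) ^ (-b) *
        (ENNReal.ofReal ((Λ * horNorm ξ) ^ (2 * n) * c * (2 * horNorm ξ ^ 2)))⁻¹) ξ
      ≤ ENNReal.ofReal (2 ^ b * Λ ^ (b - 2 * n)) * ENNReal.ofReal (horNorm η) ^ (-b) := by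
  set r := horNorm η / (2 * Λ) with hr
  have hηr : horNorm η = 2 * Λ * r := by rw [hr]; field_simp
  set h : Plane n → ℝ≥0∞ := (shell n r).indicator fun z =>
    ENNReal.ofReal (planeNorm z) ^ (-b) *
        (ENNReal.ofReal ((Λ * planeNorm z) ^ (2 * n) * c * (2 * planeNorm z ^ 2)))⁻¹ with hh
  have hmeas : Measurable h := by
    have := (continuous_planeNorm (n := n)).measurable
    exact Measurable.indicator (by fun_prop) (isOpen_shell r).measurableSet
  have hslab := lintegral_slab hmeas
    (c := fun z => η.2.2 - 2 * inner ℝ z.2 η.1 + 2 * inner ℝ z.1 η.2.1)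
    (ρ := fun z => planeNorm z ^ 2) (by fun_prop) (by fun_prop)
  have hmem : ∀ ξ : Heisenberg n, η ∈ shellBox Λ ξ ↔
      (ξ.1, ξ.2.1) ∈ shell n r ∧ |vert ξ η| < planeNorm (ξ.1, ξ.2.1) ^ 2 := fun ξ => by
    change ((Λ * horNorm ξ < horNorm η ∧ horNorm η < 2 * (Λ * horNorm ξ)) ∧ _) ↔
      ((r < horNorm ξ ∧ horNorm ξ < 2 * r) ∧ _)
    have h1 : Λ * horNorm ξ < horNorm η ↔ horNorm ξ < 2 * r := by
      rw [hηr, show 2 * Λ * r = Λ * (2 * r) by ring, mul_lt_mul_iff_right₀ hΛ]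
    have h2 : horNorm η < 2 * (Λ * horNorm ξ) ↔ r < horNorm ξ := by
      rw [hηr, _root_.mul_assoc, mul_lt_mul_iff_right₀ two_pos, mul_lt_mul_iff_right₀ hΛ]
    rw [h1, h2, and_comm (a := r < _)]
    rfl
  have hint : ∀ ξ : Heisenberg n, {ξ | η ∈ shellBox Λ ξ}.indicator
      (fun ξ => ENNReal.ofReal (horNorm ξ) ^ (-b) *
        (ENNReal.ofReal ((Λ * horNorm ξ) ^ (2 * n) * c * (2 * horNorm ξ ^ 2)))⁻¹) ξ
      = {ξ : Heisenberg n | |ξ.2.2 - (η.2.2 - 2 * inner ℝ ξ.2.1 η.1 + 2 * inner ℝ ξ.1 η.2.1)|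
          < planeNorm (ξ.1, ξ.2.1) ^ 2}.indicator (fun ξ => h (ξ.1, ξ.2.1)) ξ := fun ξ => by
    by_cases hE : η ∈ shellBox Λ ξ
    · have h1 := (hmem ξ).1 hE
      have h2 := h1.2
      rw [abs_vert_eq] at h2
      rw [Set.indicator_of_mem (by exact hE), Set.indicator_of_mem (by exact h2), hh,
        Set.indicator_of_mem h1.1]
      rfl
    · rw [Set.indicator_of_notMem (by exact hE)]
      symm
      by_cases h1 : (ξ.1, ξ.2.1) ∈ shell n r
      · refine Set.indicator_of_notMem (fun h2 => hE ((hmem ξ).2 ⟨h1, ?_⟩)) _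
        rw [abs_vert_eq]; exact h2
      · refine Set.indicator_apply_eq_zero.2 fun _ => ?_
        exact Set.indicator_of_notMem h1 _
  rw [lintegral_congr hint, hslab]
  rcases (horNorm_nonneg η).eq_or_lt with h0 | h0
  · -- on the axis the shell is empty
    have hr0 : r = 0 := by rw [hr, ← h0, zero_div]
    have : ∀ z, h z = 0 := fun z => by
      refine Set.indicator_of_notMem (fun hz => ?_) _
      have h3 := hz.2
      have h4 := planeNorm_nonneg z
      linarith
    simp [this]
  have hr0 : 0 < r := by positivity
  calc ∫⁻ z, h z * ENNReal.ofReal (2 * planeNorm z ^ 2)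
      ≤ ∫⁻ z, (shell n r).indicator
          (fun _ => ENNReal.ofReal (r ^ (-b) * ((Λ * r) ^ (2 * n) * c)⁻¹)) z := by
        refine lintegral_mono fun z => ?_
        by_cases hz : z ∈ shell n r
        · have hz0 : 0 < planeNorm z := hr0.trans hz.1
          simp only [hh, Set.indicator_of_mem hz]
          rw [ENNReal.ofReal_rpow_of_pos hz0, ← ENNReal.ofReal_inv_of_pos (by positivity),
            ← ENNReal.ofReal_mul (by positivity), ← ENNReal.ofReal_mul (by positivity)]
          refine ENNReal.ofReal_le_ofReal ?_
          have h1 : planeNorm z ^ (-b) ≤ r ^ (-b) :=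
            Real.rpow_le_rpow_of_nonpos hr0 hz.1.le (by linarith)
          have h2 : ((Λ * planeNorm z) ^ (2 * n) * c)⁻¹ ≤ ((Λ * r) ^ (2 * n) * c)⁻¹ := by
            gcongr; exact hz.1.le
          calc _ = planeNorm z ^ (-b) * ((Λ * planeNorm z) ^ (2 * n) * c)⁻¹ := by
                field_simp
            _ ≤ _ := by gcongr
        · simp [hh, hz]
    _ = ENNReal.ofReal (2 ^ b * Λ ^ (b - 2 * n)) * ENNReal.ofReal (horNorm η) ^ (-b) := by
        rw [lintegral_indicator_const (isOpen_shell r).measurableSet, hvol r hr0,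
          ENNReal.ofReal_rpow_of_pos h0, ← ENNReal.ofReal_mul (by positivity),
          ← ENNReal.ofReal_mul (by positivity), hηr, Real.mul_rpow (by positivity) hr0.le,
          Real.mul_rpow (by positivity) hΛ.le, Real.rpow_sub hΛ,
          show Λ ^ (2 * (n : ℝ)) = Λ ^ (2 * n) by rw [← Real.rpow_natCast]; push_cast; rfl,
          Real.rpow_neg two_pos.le, Real.rpow_neg hΛ.le, mul_pow]
        congr 1
        field_simp

/-- The average over shell boxes acts on the weighted integral with norm at most `2^b Λ^(b - 2n)`,
which can be made small by a choice of `Λ` exactly when `b ≠ 2n`. -/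
theorem lintegral_shellBox_average_le {b c Λ : ℝ} (hb : 0 ≤ b) (hc : 0 < c) (hΛ : 0 < Λ)
    (hvol : ∀ r : ℝ, 0 < r → volume (shell n r) = ENNReal.ofReal (r ^ (2 * n) * c))
    {g : Heisenberg n → ℝ≥0∞} (hg : Measurable g) :
    ∫⁻ ξ : Heisenberg n, ENNReal.ofReal (horNorm ξ) ^ (-b) *
        (ENNReal.ofReal ((Λ * horNorm ξ) ^ (2 * n) * c * (2 * horNorm ξ ^ 2)))⁻¹ *
          ∫⁻ η in shellBox Λ ξ, g η
      ≤ ENNReal.ofReal (2 ^ b * Λ ^ (b - 2 * n)) *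
        ∫⁻ η, ENNReal.ofReal (horNorm η) ^ (-b) * g η := by
  have h1 := (continuous_horNorm (n := n)).measurable
  set φ : Heisenberg n → ℝ≥0∞ := fun ξ => ENNReal.ofReal (horNorm ξ) ^ (-b) *
    (ENNReal.ofReal ((Λ * horNorm ξ) ^ (2 * n) * c * (2 * horNorm ξ ^ 2)))⁻¹ with hφ
  have hφm : Measurable φ := by fun_prop
  have hE := measurableSet_mem_shellBox (n := n) Λ
  have hφg : Measurable fun x : Heisenberg n × Heisenberg n => φ x.1 * g x.2 :=
    (hφm.comp measurable_fst).mul (hg.comp measurable_snd)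
  have hφE := fun η => lintegral_mem_shellBox_le hb hc hΛ hvol η
  change ∫⁻ ξ, φ ξ * ∫⁻ η in shellBox Λ ξ, g η ≤ _
  change ∀ η, ∫⁻ ξ, {ξ | η ∈ shellBox Λ ξ}.indicator φ ξ ≤ _ at hφE
  clear_value φ
  calc ∫⁻ ξ, φ ξ * ∫⁻ η in shellBox Λ ξ, g η
      = ∫⁻ ξ, ∫⁻ η, {x : Heisenberg n × Heisenberg n | x.2 ∈ shellBox Λ x.1}.indicator
          (fun x => φ x.1 * g x.2) (ξ, η) := by
        refine lintegral_congr fun ξ => ?_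
        rw [← lintegral_indicator (measurableSet_shellBox Λ ξ),
          ← lintegral_const_mul _ (hg.indicator (measurableSet_shellBox Λ ξ))]
        refine lintegral_congr fun η => ?_
        by_cases h : η ∈ shellBox Λ ξ <;> simp [Set.indicator, h]
    _ = ∫⁻ η, ∫⁻ ξ, {x : Heisenberg n × Heisenberg n | x.2 ∈ shellBox Λ x.1}.indicator
          (fun x => φ x.1 * g x.2) (ξ, η) :=
        lintegral_lintegral_swap (hφg.indicator hE).aemeasurable
    _ = ∫⁻ η, g η * ∫⁻ ξ, {ξ | η ∈ shellBox Λ ξ}.indicator φ ξ := by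
        refine lintegral_congr fun η => ?_
        rw [← lintegral_const_mul]
        · refine lintegral_congr fun ξ => ?_
          by_cases h : η ∈ shellBox Λ ξ <;> simp [Set.indicator, h, mul_comm]
        · exact hφm.indicator (measurableSet_setOf_mem_shellBox Λ η)
    _ ≤ ∫⁻ η, ENNReal.ofReal (2 ^ b * Λ ^ (b - 2 * n)) *
          (ENNReal.ofReal (horNorm η) ^ (-b) * g η) := by
        refine lintegral_mono fun η => ?_
        calc _ ≤ g η * (ENNReal.ofReal (2 ^ b * Λ ^ (b - 2 * n)) *
              ENNReal.ofReal (horNorm η) ^ (-b)) := by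
              gcongr
              exact hφE η
          _ = _ := by ring
    _ = _ := lintegral_const_mul _ (by fun_prop)

/-! ### Choice of the scale -/

/-- Given `M ^ p ≤ K ρ ^ (p θ) Y` and, at every scale `r ≤ ρ`, one of `M ^ p ≤ K r ^ (p θ) Y` and
`M ^ τ r ^ Q ≤ L ρ ^ b J`, a power of `M` is bounded by a geometric mean of `Y` and `J`: at the
scale where `K r ^ (p θ) Y = M ^ p / 2` the second alternative must hold. -/
theorem rpow_le_of_scales {p θ τ b a e Q ρ M Y J K L : ℝ} (hp : 0 < p) (hθ : 0 < θ)
    (hb : 0 ≤ b) (he₀ : 0 ≤ e) (he₁ : e ≤ 1) (hρ : 0 < ρ)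
    (hM : 0 < M) (hY : 0 < Y) (hJ : 0 < J) (hK : 0 < K) (hL : 0 < L)
    (hrel : Q * (1 - e) - a * τ * e * θ = -(b * e))
    (h₁ : M ^ p ≤ K * ρ ^ (p * θ) * Y)
    (h₂ : ∀ r, 0 < r → r ≤ ρ → M ^ p ≤ K * r ^ (p * θ) * Y ∨ M ^ τ * r ^ Q ≤ L * ρ ^ b * J) :
    ρ ^ (-b) * M ^ (τ * (1 - (1 - a) * e))
      ≤ (2 * K) ^ (a * τ * e / p) * L ^ (1 - e) * (Y ^ (a * τ * e / p) * J ^ (1 - e)) := by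
  have hk : 0 < p * θ := mul_pos hp hθ
  set r := (M ^ p / (2 * K * Y)) ^ (p * θ)⁻¹ with hr
  have hr0 : 0 < r := by positivity
  have hrk : r ^ (p * θ) = M ^ p / (2 * K * Y) := Real.rpow_inv_rpow (by positivity) hk.ne'
  have hMr : M ^ p = 2 * K * Y * r ^ (p * θ) := by rw [hrk]; field_simp
  have hMp : 0 < M ^ p := by positivity
  have hrρ : r ≤ ρ := by
    rw [← Real.rpow_le_rpow_iff hr0.le hρ.le hk, hrk, div_le_iff₀ (by positivity)]
    nlinarith
  have h3 : M ^ τ * r ^ Q ≤ L * ρ ^ b * J := by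
    refine (h₂ r hr0 hrρ).resolve_left fun h => ?_
    have : K * r ^ (p * θ) * Y = M ^ p / 2 := by rw [hMr]; ring
    linarith
  have h4 : M ^ τ * r ^ Q * ρ ^ (-b) ≤ L * J := by
    calc M ^ τ * r ^ Q * ρ ^ (-b) ≤ L * ρ ^ b * J * ρ ^ (-b) := by gcongr
      _ = L * J := by rw [Real.rpow_neg hρ.le]; field_simp
  have h5 : 2 * K * Y = M ^ p * r ^ (-(p * θ)) := by
    rw [hMr, Real.rpow_neg hr0.le]; field_simp
  calc ρ ^ (-b) * M ^ (τ * (1 - (1 - a) * e))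
      = M ^ (τ * (1 - (1 - a) * e)) * ρ ^ (-(b * e)) * ρ ^ (-b * (1 - e)) := by
        rw [_root_.mul_assoc, ← Real.rpow_add hρ, mul_comm]; congr 2; ring
    _ ≤ M ^ (τ * (1 - (1 - a) * e)) * r ^ (-(b * e)) * ρ ^ (-b * (1 - e)) := by
        gcongr ?_ * ?_ * ?_
        exact Real.rpow_le_rpow_of_nonpos hr0 hrρ (by nlinarith)
    _ = (M ^ p * r ^ (-(p * θ))) ^ (a * τ * e / p) * (M ^ τ * r ^ Q * ρ ^ (-b)) ^ (1 - e) := by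
        rw [Real.mul_rpow (by positivity) (by positivity), Real.mul_rpow (by positivity)
          (by positivity), Real.mul_rpow (by positivity) (by positivity), ← Real.rpow_mul hM.le,
          ← Real.rpow_mul hM.le, ← Real.rpow_mul hr0.le, ← Real.rpow_mul hr0.le,
          ← Real.rpow_mul hρ.le, show τ * (1 - (1 - a) * e)
            = p * (a * τ * e / p) + τ * (1 - e) by field_simp; ring,
          show -(b * e) = -(p * θ) * (a * τ * e / p) + Q * (1 - e) by
            rw [← hrel]; field_simp; ring, Real.rpow_add hM, Real.rpow_add hr0]
        ring
    _ ≤ (2 * K * Y) ^ (a * τ * e / p) * (L * J) ^ (1 - e) := by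
        rw [h5]
        gcongr
    _ = _ := by
        rw [Real.mul_rpow (by positivity) hY.le, Real.mul_rpow hL.le hJ.le]
        ring

/-! ### The pointwise estimate -/

theorem rpow_neg_le_rpow_neg {x y : ℝ≥0∞} (h : x ≤ y) {b : ℝ} (hb : 0 ≤ b) :
    y ^ (-b) ≤ x ^ (-b) := by
  rw [ENNReal.rpow_neg, ENNReal.rpow_neg]
  exact ENNReal.inv_le_inv.2 (ENNReal.rpow_le_rpow h hb)

theorem two_rpow_eq_ofReal (x : ℝ) : (2 : ℝ≥0∞) ^ x = ENNReal.ofReal (2 ^ x) := by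
  rw [← ENNReal.ofReal_rpow_of_pos two_pos, ENNReal.ofReal_ofNat]

/-- The integral `∫ |z|^(-b) |f|^τ`, with values in `[0, ∞]`. For `b > 0` the weight is `∞` on the
axis. -/
noncomputable def weightedIntegral (b τ : ℝ) (f : Heisenberg n → ℝ) : ℝ≥0∞ :=
  ∫⁻ ξ : Heisenberg n, ENNReal.ofReal (horNorm ξ) ^ (-b) * ‖f ξ‖ₑ ^ τ

/-- If `r ≤ |z|`, then `|z'| ≤ 2 |z|` on `box ξ r`, so the weight is bounded below there. -/
theorem setLIntegral_box_le {b τ : ℝ} (hb : 0 ≤ b) (f : Heisenberg n → ℝ) {ξ : Heisenberg n}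
    (hξ : 0 < horNorm ξ) {r : ℝ} (hr : r ≤ horNorm ξ) :
    ∫⁻ η in box ξ r, ‖f η‖ₑ ^ τ
      ≤ ENNReal.ofReal ((2 * horNorm ξ) ^ b) * weightedIntegral b τ f := by
  rw [weightedIntegral, ← lintegral_const_mul' _ _ ENNReal.ofReal_ne_top]
  refine (setLIntegral_mono' (measurableSet_box ξ r) fun η hη => ?_).trans
    (setLIntegral_le_lintegral _ _)
  have h1 : ENNReal.ofReal (2 * horNorm ξ) ^ (-b) ≤ ENNReal.ofReal (horNorm η) ^ (-b) :=
    rpow_neg_le_rpow_neg (ENNReal.ofReal_le_ofReal (horNorm_le_of_mem_box hη hr)) hb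
  have h2 : ENNReal.ofReal ((2 * horNorm ξ) ^ b) * ENNReal.ofReal (2 * horNorm ξ) ^ (-b) = 1 := by
    rw [ENNReal.ofReal_rpow_of_pos (by positivity), ← ENNReal.ofReal_mul (by positivity),
      ← Real.rpow_add (by positivity)]
    simp
  calc ‖f η‖ₑ ^ τ = ENNReal.ofReal ((2 * horNorm ξ) ^ b) *
        ENNReal.ofReal (2 * horNorm ξ) ^ (-b) * ‖f η‖ₑ ^ τ := by rw [h2, one_mul]
    _ ≤ ENNReal.ofReal ((2 * horNorm ξ) ^ b) *
        ENNReal.ofReal (horNorm η) ^ (-b) * ‖f η‖ₑ ^ τ := by gcongr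
    _ = _ := by ring

/-- `energy_or_average` on `box ξ r`, in real numbers. -/
theorem exists_energy_or_norm_box {s p β τ b : ℝ} (hp : 0 < p) (hs : 0 < s) (hβ : 0 ≤ β)
    (hτ : 0 < τ) (hb : 0 ≤ b) :
    ∃ K L : ℝ, 0 < K ∧ 0 < L ∧ ∀ f : Heisenberg n → ℝ, Measurable f → ∀ ξ : Heisenberg n,
      0 < horNorm ξ → ∀ y j : ℝ, 0 ≤ y → 0 ≤ j →
      energyDensity s p β f ξ = ENNReal.ofReal y → weightedIntegral b τ f = ENNReal.ofReal j →
      0 < |f ξ| → ∀ r : ℝ, 0 < r → r ≤ horNorm ξ →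
      |f ξ| ^ p ≤ K * r ^ (p * (s + β / p)) * y ∨
        |f ξ| ^ τ * r ^ homDim n ≤ L * horNorm ξ ^ b * j := by
  obtain ⟨c, hc, hvol⟩ := exists_volume_box (n := n)
  refine ⟨2 ^ (p + 1) * 2 ^ (homDim n + p * s + β) / c, 2 ^ (τ + 1) * 2 ^ b / c, by positivity,
    by positivity, fun f hf ξ hξ y j hy hj hyE hjW hM r hr hrξ => ?_⟩
  have key := energy_or_average hp hs hβ hτ hf (measurableSet_box ξ r) hr
    (fun η hη => horNorm_sub_le_of_mem_box hη) (fun η hη => le_of_lt hη.2)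
  rw [hvol ξ r hr, hyE, Real.enorm_eq_ofReal_abs, ENNReal.ofReal_rpow_of_pos hM,
    ENNReal.ofReal_rpow_of_pos hM, ← ENNReal.ofReal_mul (by positivity),
    ← ENNReal.ofReal_mul (by positivity), ENNReal.ofReal_rpow_of_pos (by positivity),
    ← ENNReal.ofReal_mul (by positivity), two_rpow_eq_ofReal, two_rpow_eq_ofReal,
    ← ENNReal.ofReal_mul (by positivity)] at key
  refine key.imp (fun h => ?_) (fun h => ?_)
  · rw [ENNReal.ofReal_le_ofReal_iff (by positivity), Real.mul_rpow two_pos.le hr.le,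
      show homDim n + p * s + β = homDim n + p * (s + β / p) by field_simp; ring,
      Real.rpow_add hr] at h
    have hrQ : 0 < r ^ homDim n := by positivity
    rw [show homDim n + p * s + β = homDim n + p * (s + β / p) by field_simp; ring]
    have h3 : |f ξ| ^ p * c * r ^ homDim n ≤ 2 ^ (p + 1) * 2 ^ (homDim n + p * (s + β / p)) *
        r ^ (p * (s + β / p)) * y * r ^ homDim n := by linarith
    have h4 := le_of_mul_le_mul_right h3 hrQ
    calc _ ≤ 2 ^ (p + 1) * 2 ^ (homDim n + p * (s + β / p)) *
        r ^ (p * (s + β / p)) * y / c := (le_div_iff₀ hc).2 h4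
      _ = _ := by ring
  · have h3 := h.trans (mul_le_mul_right (setLIntegral_box_le hb f hξ hrξ) _)
    rw [hjW, ← ENNReal.ofReal_mul (by positivity), ← ENNReal.ofReal_mul (by positivity),
      ENNReal.ofReal_le_ofReal_iff (by positivity), Real.mul_rpow two_pos.le hξ.le] at h3
    calc _ ≤ 2 ^ (τ + 1) * (2 ^ b * horNorm ξ ^ b * j) / c := by
          rw [le_div_iff₀ hc]; linarith
      _ = _ := by ring

/-- `energy_or_average` on `shellBox Λ ξ`, with the energy alternative in real numbers. -/
theorem exists_energy_or_shellBox_average {s p β τ c Λ : ℝ} (hp : 0 < p) (hs : 0 < s)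
    (hβ : 0 ≤ β) (hτ : 0 < τ) (hc : 0 < c) (hΛ : 0 < Λ)
    (hvol : ∀ ξ : Heisenberg n, 0 < horNorm ξ → volume (shellBox Λ ξ)
      = ENNReal.ofReal ((Λ * horNorm ξ) ^ (2 * n) * c * (2 * horNorm ξ ^ 2))) :
    ∃ K : ℝ, 0 < K ∧ ∀ f : Heisenberg n → ℝ, Measurable f → ∀ ξ : Heisenberg n,
      0 < horNorm ξ →
      (∀ y : ℝ, 0 ≤ y → energyDensity s p β f ξ = ENNReal.ofReal y → 0 < |f ξ| →
        |f ξ| ^ p ≤ K * horNorm ξ ^ (p * (s + β / p)) * y) ∨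
      ‖f ξ‖ₑ ^ τ ≤ 2 ^ (τ + 1) *
        ((ENNReal.ofReal ((Λ * horNorm ξ) ^ (2 * n) * c * (2 * horNorm ξ ^ 2)))⁻¹ *
          ∫⁻ η in shellBox Λ ξ, ‖f η‖ₑ ^ τ) := by
  have hQ : 0 ≤ homDim n := by unfold homDim; positivity
  refine ⟨2 ^ (p + 1) * (2 * (1 + 2 * Λ)) ^ (homDim n + p * s + β) / (Λ ^ (2 * n) * c * 2),
    by positivity, fun f hf ξ hξ => ?_⟩
  have hR : 0 < (1 + 2 * Λ) * horNorm ξ := by positivity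
  have key := energy_or_average hp hs hβ hτ hf (measurableSet_shellBox Λ ξ) hR
    (fun η hη => horNorm_sub_le_of_mem_shellBox hη) (fun η hη => (le_of_lt hη.2).trans <| by
      have : 1 ≤ 1 + 2 * Λ := by linarith
      nlinarith [mul_le_mul this this zero_le_one (by positivity), sq_nonneg (horNorm ξ)])
  rw [hvol ξ hξ] at key
  refine key.imp (fun h y hy hyE hM => ?_) (fun h => ?_)
  · rw [hyE, Real.enorm_eq_ofReal_abs, ENNReal.ofReal_rpow_of_pos hM,
      ← ENNReal.ofReal_mul (by positivity),
      ENNReal.ofReal_rpow_of_pos (by positivity),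
      ← ENNReal.ofReal_mul (by positivity), two_rpow_eq_ofReal,
      ← ENNReal.ofReal_mul (by positivity), ENNReal.ofReal_le_ofReal_iff (by positivity),
      ← _root_.mul_assoc 2, Real.mul_rpow (by positivity) hξ.le, mul_pow] at h
    have hρ : horNorm ξ ^ (homDim n + p * s + β)
        = horNorm ξ ^ (2 * n) * horNorm ξ ^ 2 * horNorm ξ ^ (p * (s + β / p)) := by
      rw [← Real.rpow_natCast, ← Real.rpow_natCast, ← Real.rpow_add hξ, ← Real.rpow_add hξ,
        homDim]
      congr 1
      push_cast
      field_simp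
      ring
    rw [hρ] at h
    have hρ2 : 0 < horNorm ξ ^ (2 * n) * horNorm ξ ^ 2 := by positivity
    have h3 : |f ξ| ^ p * (Λ ^ (2 * n) * c * 2) * (horNorm ξ ^ (2 * n) * horNorm ξ ^ 2)
        ≤ 2 ^ (p + 1) * (2 * (1 + 2 * Λ)) ^ (homDim n + p * s + β) *
          horNorm ξ ^ (p * (s + β / p)) * y * (horNorm ξ ^ (2 * n) * horNorm ξ ^ 2) := by
      linarith
    have h4 := le_of_mul_le_mul_right h3 hρ2
    calc _ ≤ _ / (Λ ^ (2 * n) * c * 2) := (le_div_iff₀ (by positivity)).2 h4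
      _ = _ := by ring
  · have hV : 0 < (Λ * horNorm ξ) ^ (2 * n) * c * (2 * horNorm ξ ^ 2) := by positivity
    calc ‖f ξ‖ₑ ^ τ ≤ (2 ^ (τ + 1) * ∫⁻ η in shellBox Λ ξ, ‖f η‖ₑ ^ τ) /
          ENNReal.ofReal ((Λ * horNorm ξ) ^ (2 * n) * c * (2 * horNorm ξ ^ 2)) := by
          rw [ENNReal.le_div_iff_mul_le (by simp [hV]) (by simp)]
          exact h
      _ = _ := by rw [div_eq_mul_inv]; ring

/-- Either the shell average controls `|f ξ|`, or the energy density does at scale `|z|`; in the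
second case `rpow_le_of_scales` combines this with the alternatives on the smaller boxes. -/
theorem exists_pointwise_bound {s p β τ b a e c Λ : ℝ} (hp : 0 < p) (hs : 0 < s)
    (hβ : 0 ≤ β) (hτ : 0 < τ) (hb : 0 ≤ b) (ha₀ : 0 < a) (he₀ : 0 < e) (he₁ : e ≤ 1)
    (hrel : homDim n * (1 - e) - a * τ * e * (s + β / p) = -(b * e)) (hc : 0 < c) (hΛ : 0 < Λ)
    (hvol : ∀ ξ : Heisenberg n, 0 < horNorm ξ → volume (shellBox Λ ξ)
      = ENNReal.ofReal ((Λ * horNorm ξ) ^ (2 * n) * c * (2 * horNorm ξ ^ 2))) :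
    ∃ C : ℝ, 0 < C ∧ ∀ f : Heisenberg n → ℝ, Measurable f →
      weightedIntegral b τ f ≠ 0 → weightedIntegral b τ f ≠ ∞ → ∀ ξ : Heisenberg n,
      0 < horNorm ξ →
      ENNReal.ofReal (horNorm ξ) ^ (-b) * ‖f ξ‖ₑ ^ τ
        ≤ ENNReal.ofReal C * weightedIntegral b τ f ^ (1 - e) *
            (energyDensity s p β f ξ ^ (a * τ * e / p) * ‖f ξ‖ₑ ^ ((1 - a) * τ * e)) +
          2 ^ (τ + 1) * (ENNReal.ofReal (horNorm ξ) ^ (-b) *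
            (ENNReal.ofReal ((Λ * horNorm ξ) ^ (2 * n) * c * (2 * horNorm ξ ^ 2)))⁻¹ *
              ∫⁻ η in shellBox Λ ξ, ‖f η‖ₑ ^ τ) := by
  obtain ⟨K₁, hK₁, h₁⟩ := exists_energy_or_shellBox_average (n := n) hp hs hβ hτ hc hΛ hvol
  obtain ⟨K₂, L, hK₂, hL, h₂⟩ := exists_energy_or_norm_box (n := n) hp hs hβ hτ hb
  set K := max K₁ K₂
  have hK : 0 < K := lt_max_of_lt_left hK₁
  refine ⟨(2 * K) ^ (a * τ * e / p) * L ^ (1 - e), by positivity,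
    fun f hf hJ0 hJt ξ hξ => ?_⟩
  have hA : 0 < a * τ * e / p := by positivity
  rcases (abs_nonneg (f ξ)).eq_or_lt with hM | hM
  · have : f ξ = 0 := abs_eq_zero.1 hM.symm
    simp [this, ENNReal.zero_rpow_of_pos hτ]
  rcases h₁ f hf ξ hξ with h₁ | h₁
  swap
  · refine le_add_left ((mul_le_mul_right h₁ _).trans_eq ?_)
    ring
  refine le_add_right ?_
  have hMe : ‖f ξ‖ₑ ≠ 0 := by simpa using hM
  rcases eq_or_ne (energyDensity s p β f ξ) ∞ with hY | hY
  · -- an infinite energy density makes the right-hand side infinite, as its exponent is positive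
    have h3 : ‖f ξ‖ₑ ^ ((1 - a) * τ * e) ≠ 0 :=
      (ENNReal.rpow_pos (pos_iff_ne_zero.2 hMe) enorm_ne_top).ne'
    have h4 : weightedIntegral b τ f ^ (1 - e) ≠ 0 :=
      (ENNReal.rpow_pos (pos_iff_ne_zero.2 hJ0) hJt).ne'
    rw [hY, ENNReal.top_rpow_of_pos hA, ENNReal.top_mul h3, ENNReal.mul_top]
    · exact le_top
    · refine mul_ne_zero ?_ h4
      simp only [ne_eq, ENNReal.ofReal_eq_zero, not_le]
      positivity
  obtain ⟨y, hy, hyE⟩ : ∃ y : ℝ, 0 ≤ y ∧ energyDensity s p β f ξ = ENNReal.ofReal y :=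
    ⟨_, ENNReal.toReal_nonneg, (ENNReal.ofReal_toReal hY).symm⟩
  obtain ⟨j, hj, hjW⟩ : ∃ j : ℝ, 0 < j ∧ weightedIntegral b τ f = ENNReal.ofReal j :=
    ⟨_, ENNReal.toReal_pos hJ0 hJt, (ENNReal.ofReal_toReal hJt).symm⟩
  have hMp : 0 < |f ξ| ^ p := by positivity
  have h5 := h₁ y hy hyE hM
  have hθ : 0 < s + β / p := by positivity
  have hy0 : 0 < y := by
    refine hy.lt_of_ne fun h => ?_
    rw [← h, MulZeroClass.mul_zero] at h5
    linarith
  have key := rpow_le_of_scales (a := a) hp hθ hb he₀.le he₁ hξ hM hy0 hj hK hL hrel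
    (h5.trans (by gcongr; exact le_max_left _ _)) fun r hr hrξ =>
      (h₂ f hf ξ hξ y j hy hj.le hyE hjW hM r hr hrξ).imp_left fun h =>
        h.trans (by gcongr; exact le_max_right _ _)
  rw [hyE, hjW, Real.enorm_eq_ofReal_abs, ENNReal.ofReal_rpow_of_pos hξ,
    ENNReal.ofReal_rpow_of_pos hM, ENNReal.ofReal_rpow_of_pos hM, ENNReal.ofReal_rpow_of_pos hj,
    ENNReal.ofReal_rpow_of_pos hy0, ← ENNReal.ofReal_mul (by positivity),
    ← ENNReal.ofReal_mul (by positivity), ← ENNReal.ofReal_mul (by positivity),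
    ← ENNReal.ofReal_mul (by positivity)]
  refine ENNReal.ofReal_le_ofReal ?_
  calc horNorm ξ ^ (-b) * |f ξ| ^ τ
      = horNorm ξ ^ (-b) * |f ξ| ^ (τ * (1 - (1 - a) * e)) * |f ξ| ^ ((1 - a) * τ * e) := by
        rw [_root_.mul_assoc, ← Real.rpow_add hM]; congr 2; ring
    _ ≤ (2 * K) ^ (a * τ * e / p) * L ^ (1 - e) * (y ^ (a * τ * e / p) * j ^ (1 - e)) *
        |f ξ| ^ ((1 - a) * τ * e) := by gcongr
    _ = _ := by ring

/-! ### Absorption of the shell averages -/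

theorem ae_horNorm_pos (hn : 1 ≤ n) : ∀ᵐ ξ : Heisenberg n, 0 < horNorm ξ := by
  have : Nontrivial (EuclideanSpace ℝ (Fin n)) := by
    have : Nonempty (Fin n) := ⟨⟨0, hn⟩⟩
    infer_instance
  rw [ae_iff]
  refine measure_mono_null (t := ({0} : Set (EuclideanSpace ℝ (Fin n))) ×ˢ Set.univ)
    (fun ξ hξ => ?_) ?_
  · have h : planeNorm (ξ.1, ξ.2.1) = 0 := le_antisymm (not_lt.1 hξ) (planeNorm_nonneg _)
    have := planeNorm_eq_zero.1 h
    simpa using congrArg Prod.fst this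
  · rw [Measure.volume_eq_prod, Measure.prod_prod]
    simp

/-- The inequality for the weight `|z|^(-b)`, in the range `b ≤ a τ (s + β / p)`, for every
measurable `f` whose weighted integral is finite. The finiteness is what allows the absorption. -/
theorem exists_weightedIntegral_rpow_le (hn : 1 ≤ n) {s p β τ b a q : ℝ} (hp : 0 < p)
    (hs : 0 < s) (hβ : 0 ≤ β) (hτ : 0 < τ) (hb : 0 ≤ b) (hbn : b ≠ 2 * n) (ha₀ : 0 < a)
    (ha₁ : a ≤ 1) (hq : 0 < q) (hba : b ≤ a * τ * (s + β / p))
    (hbal : 1 / τ - b / τ / homDim n = a * (1 / p - (s + β / p) / homDim n) + (1 - a) / q) :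
    ∃ C : ℝ≥0, ∀ f : Heisenberg n → ℝ, Measurable f → weightedIntegral b τ f ≠ ∞ →
      weightedIntegral b τ f ^ (1 / τ) ≤ C * ((∫⁻ ξ, energyDensity s p β f ξ) ^ (1 / p)) ^ a *
        ((∫⁻ ξ, ‖f ξ‖ₑ ^ q) ^ (1 / q)) ^ (1 - a) := by
  have hQ : 0 < homDim n := by unfold homDim; positivity
  set θ := s + β / p with hθ
  -- the exponent for which the two powers in the pointwise bound fit Hölder's inequality
  set e := homDim n / (homDim n + (a * τ * θ - b)) with he
  have hden : 0 < homDim n + (a * τ * θ - b) := by linarith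
  have he₀ : 0 < e := by positivity
  have he₁ : e ≤ 1 := (div_le_one hden).2 (by linarith)
  have hee : e * (homDim n + (a * τ * θ - b)) = homDim n := div_mul_cancel₀ _ hden.ne'
  have hrel : homDim n * (1 - e) - a * τ * e * θ = -(b * e) := by linarith
  have hsum : a * τ * e / p + (1 - a) * τ * e / q = 1 := by
    have h1 : a / p + (1 - a) / q = (homDim n + (a * τ * θ - b)) / (τ * homDim n) := by
      have h2 : a / p + (1 - a) / q = 1 / τ - b / τ / homDim n + a * θ / homDim n := by
        rw [hbal]; ring
      rw [h2]; field_simp; ring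
    calc _ = τ * e * (a / p + (1 - a) / q) := by ring
      _ = e * (homDim n + (a * τ * θ - b)) / homDim n := by rw [h1]; field_simp
      _ = 1 := by rw [hee, div_self hQ.ne']
  -- the aperture for which the averaging term is absorbed
  have hbn' : 2 * (n : ℝ) - b ≠ 0 := sub_ne_zero.2 hbn.symm
  set Λ : ℝ := (2 ^ (τ + b + 2)) ^ (2 * (n : ℝ) - b)⁻¹ with hΛ
  have hΛ0 : 0 < Λ := by positivity
  have hΛb : 2 ^ (τ + 1) * (2 ^ b * Λ ^ (b - 2 * n)) = 1 / 2 := by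
    rw [hΛ, ← Real.rpow_mul (by positivity), show (2 * (n : ℝ) - b)⁻¹ * (b - 2 * n) = -1 by
      field_simp; ring, ← Real.rpow_mul two_pos.le, ← Real.rpow_add two_pos,
      ← Real.rpow_add two_pos]
    rw [show τ + 1 + (b + (τ + b + 2) * -1) = -1 by ring, Real.rpow_neg_one]
    norm_num
  obtain ⟨c, hc, hshell, hvol⟩ := exists_volume_shellBox hn
  obtain ⟨C, hC, hpt⟩ := exists_pointwise_bound (n := n) hp hs hβ hτ hb ha₀ he₀ he₁ hrel hc hΛ0
    fun ξ hξ => hvol Λ ξ hΛ0 hξ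
  refine ⟨(2 * C.toNNReal) ^ (1 / (e * τ)), fun f hf hJt => ?_⟩
  set J := weightedIntegral b τ f with hJ
  rcases eq_or_ne J 0 with hJ0 | hJ0
  · rw [hJ0, ENNReal.zero_rpow_of_pos (by positivity)]; exact zero_le
  set E := ∫⁻ ξ, energyDensity s p β f ξ with hE
  set G := ∫⁻ ξ, ‖f ξ‖ₑ ^ q with hG
  have hw := (continuous_horNorm (n := n)).measurable
  have hEm := measurable_energyDensity (s := s) (p := p) (β := β) hf
  have holder : ∫⁻ ξ, energyDensity s p β f ξ ^ (a * τ * e / p) * ‖f ξ‖ₑ ^ ((1 - a) * τ * e)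
      ≤ E ^ (a * τ * e / p) * G ^ ((1 - a) * τ * e / q) := by
    have := ENNReal.lintegral_mul_norm_pow_le (μ := (volume : Measure (Heisenberg n)))
      hEm.aemeasurable (hf.enorm.pow_const q).aemeasurable
      (show 0 ≤ a * τ * e / p by positivity)
      (show 0 ≤ (1 - a) * τ * e / q from
        div_nonneg (mul_nonneg (mul_nonneg (by linarith) hτ.le) he₀.le) hq.le) hsum
    refine le_of_eq_of_le (lintegral_congr fun ξ => ?_) this
    rw [← ENNReal.rpow_mul]
    congr 2
    field_simp
  have hcoef : 2 ^ (τ + 1) * ENNReal.ofReal (2 ^ b * Λ ^ (b - 2 * n)) = (2 : ℝ≥0∞)⁻¹ := by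
    rw [two_rpow_eq_ofReal, ← ENNReal.ofReal_mul (by positivity), hΛb, one_div,
      ENNReal.ofReal_inv_of_pos two_pos, ENNReal.ofReal_ofNat]
  have habsorb : J ≤ ENNReal.ofReal C * J ^ (1 - e) *
      (E ^ (a * τ * e / p) * G ^ ((1 - a) * τ * e / q)) + J / 2 := by
    calc J ≤ ∫⁻ ξ, (ENNReal.ofReal C * J ^ (1 - e) *
            (energyDensity s p β f ξ ^ (a * τ * e / p) * ‖f ξ‖ₑ ^ ((1 - a) * τ * e)) +
          2 ^ (τ + 1) * (ENNReal.ofReal (horNorm ξ) ^ (-b) *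
            (ENNReal.ofReal ((Λ * horNorm ξ) ^ (2 * n) * c * (2 * horNorm ξ ^ 2)))⁻¹ *
              ∫⁻ η in shellBox Λ ξ, ‖f η‖ₑ ^ τ)) :=
          lintegral_mono_ae ((ae_horNorm_pos hn).mono fun ξ hξ => hpt f hf hJ0 hJt ξ hξ)
      _ ≤ _ := by
          rw [lintegral_add_left (by fun_prop), lintegral_const_mul _ (by fun_prop),
            lintegral_const_mul' _ _ (ENNReal.rpow_ne_top_of_nonneg (by positivity) (by simp))]
          gcongr
          rw [ENNReal.div_eq_inv_mul, ← hcoef, _root_.mul_assoc]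
          gcongr
          exact lintegral_shellBox_average_le hb hc hΛ0 hshell (hf.enorm.pow_const τ)
  have hJ2 : J ≤ 2 * (ENNReal.ofReal C * J ^ (1 - e) *
      (E ^ (a * τ * e / p) * G ^ ((1 - a) * τ * e / q))) := by
    have h1 : J / 2 ≠ ∞ := ENNReal.div_ne_top hJt two_ne_zero
    nth_rewrite 1 [← ENNReal.add_halves J] at habsorb
    have h2 := (ENNReal.add_le_add_iff_right h1).1 habsorb
    calc J = 2 * (J / 2) := (ENNReal.mul_div_cancel two_ne_zero ENNReal.ofNat_ne_top).symm
      _ ≤ _ := by gcongr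
  have hJe : J ^ e ≤ 2 * ENNReal.ofReal C *
      (E ^ (a * τ * e / p) * G ^ ((1 - a) * τ * e / q)) := by
    have hpos : J ^ (1 - e) ≠ 0 := (ENNReal.rpow_pos (pos_iff_ne_zero.2 hJ0) hJt).ne'
    have hfin : J ^ (1 - e) ≠ ∞ := ENNReal.rpow_ne_top_of_nonneg (by linarith) hJt
    rw [show e = 1 - (1 - e) by ring, ENNReal.rpow_sub _ _ hJ0 hJt, ENNReal.rpow_one,
      ENNReal.div_le_iff hpos hfin]
    refine hJ2.trans_eq ?_
    rw [show 1 - (1 - e) = e by ring]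
    ring
  have hexp : 0 ≤ 1 / (e * τ) := by positivity
  calc J ^ (1 / τ) = (J ^ e) ^ (1 / (e * τ)) := by
        rw [← ENNReal.rpow_mul]; congr 1; field_simp
    _ ≤ (2 * ENNReal.ofReal C * (E ^ (a * τ * e / p) * G ^ ((1 - a) * τ * e / q)))
        ^ (1 / (e * τ)) := ENNReal.rpow_le_rpow hJe hexp
    _ = _ := by
        rw [ENNReal.mul_rpow_of_nonneg (2 * ENNReal.ofReal C) _ hexp,
          ENNReal.mul_rpow_of_nonneg (E ^ _) _ hexp, ← ENNReal.rpow_mul, ← ENNReal.rpow_mul,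
          ← ENNReal.rpow_mul, ← ENNReal.rpow_mul, ENNReal.coe_rpow_of_nonneg _ hexp,
          ENNReal.coe_mul, ← _root_.mul_assoc]
        congr 1
        · congr 2
          field_simp
        · congr 1
          field_simp

/-! ### Finiteness of the weighted integral -/

theorem lintegral_planeNorm_rpow_neg_ne_top (hn : 1 ≤ n) {b : ℝ} (hb : 0 ≤ b) (hbn : b < 2 * n)
    {r : ℝ} (hr : 0 < r) :
    ∫⁻ z in Metric.ball (0 : Plane n) r, ENNReal.ofReal (planeNorm z) ^ (-b) ≠ ∞ := by
  have : Nontrivial (EuclideanSpace ℝ (Fin n)) := by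
    have : Nonempty (Fin n) := ⟨⟨0, hn⟩⟩
    infer_instance
  have hint : IntegrableOn (fun z : Plane n => ‖z‖ ^ (-b)) (Metric.ball 0 r) := by
    refine (integrableOn_fun_norm_addHaar (μ := (volume : Measure (Plane n)))
      (f := fun y : ℝ => y ^ (-b))).2 ?_
    rw [finrank_plane]
    have h1 : IntegrableOn (fun y : ℝ => y ^ ((2 * n : ℝ) - 1 - b)) (Set.Ioo 0 r) :=
      (intervalIntegral.integrableOn_Ioo_rpow_iff hr).2 (by linarith)
    refine h1.congr_fun (fun y hy => ?_) measurableSet_Ioo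
    have hy0 : 0 < y := hy.1
    simp only [smul_eq_mul]
    rw [← Real.rpow_natCast, ← Real.rpow_add hy0, Nat.cast_sub (by omega)]
    congr 1
    push_cast; ring
  refine ne_top_of_le_ne_top hint.lintegral_lt_top.ne (lintegral_mono_ae ?_)
  have h0 : ∀ᵐ z : Plane n, z ≠ 0 := by
    rw [ae_iff]
    refine measure_mono_null (t := ({0} : Set (EuclideanSpace ℝ (Fin n))) ×ˢ Set.univ)
      (fun z hz => by simp [not_not.1 hz]) ?_
    rw [Measure.volume_eq_prod, Measure.prod_prod]
    simp
  refine ae_restrict_of_ae (h0.mono fun z hz => ?_)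
  rw [← ENNReal.ofReal_rpow_of_pos (norm_pos_iff.2 hz)]
  exact rpow_neg_le_rpow_neg (ENNReal.ofReal_le_ofReal (norm_le_planeNorm z)) hb

theorem exists_enorm_le {f : Heisenberg n → ℝ} (hf : Continuous f) (hc : HasCompactSupport f) :
    ∃ B : ℝ≥0, ∀ ξ, ‖f ξ‖ₑ ≤ B := by
  obtain ⟨B, hB⟩ := hc.exists_bound_of_continuous hf
  refine ⟨B.toNNReal, fun ξ => ?_⟩
  rw [← ofReal_norm]
  exact ENNReal.ofReal_le_ofReal (hB ξ)

/-- For `b < 2n` the weight `|z|^(-b)` is locally integrable. -/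
theorem weightedIntegral_ne_top_of_lt (hn : 1 ≤ n) {b τ : ℝ} (hb : 0 ≤ b) (hbn : b < 2 * n)
    (hτ : 0 < τ) {f : Heisenberg n → ℝ} (hf : Continuous f) (hc : HasCompactSupport f) :
    weightedIntegral b τ f ≠ ∞ := by
  obtain ⟨B, hB⟩ := exists_enorm_le hf hc
  obtain ⟨r, hr0, hr⟩ := hc.isBounded.subset_ball_lt 0 0
  have hw := (continuous_planeNorm (n := n)).measurable
  set h : Plane n → ℝ≥0∞ := (Metric.ball 0 r).indicator fun z =>
    ENNReal.ofReal (planeNorm z) ^ (-b) * (B : ℝ≥0∞) ^ τ with hh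
  have hm : Measurable h := Measurable.indicator (by fun_prop) Metric.isOpen_ball.measurableSet
  have hslab := lintegral_slab hm (c := fun _ => 0) (ρ := fun _ => r) measurable_const
    measurable_const
  have hBt : (B : ℝ≥0∞) ^ τ ≠ ∞ := ENNReal.rpow_ne_top_of_nonneg hτ.le ENNReal.coe_ne_top
  have hfin : ∫⁻ z, h z * ENNReal.ofReal (2 * r) ≠ ∞ := by
    rw [lintegral_mul_const' _ _ ENNReal.ofReal_ne_top,
      lintegral_indicator Metric.isOpen_ball.measurableSet, lintegral_mul_const' _ _ hBt]
    exact ENNReal.mul_ne_top (ENNReal.mul_ne_top (lintegral_planeNorm_rpow_neg_ne_top hn hb hbn hr0)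
      hBt) ENNReal.ofReal_ne_top
  refine ne_top_of_le_ne_top (hslab ▸ hfin) (lintegral_mono fun ξ => ?_)
  by_cases hξ : ξ ∈ tsupport f
  · have h1 : ‖ξ‖ < r := by simpa using hr hξ
    have h2 : (ξ.1, ξ.2.1) ∈ Metric.ball (0 : Plane n) r := by
      rw [mem_ball_zero_iff]
      exact (max_le_max le_rfl (le_max_left _ _)).trans_lt h1
    have h3 : |ξ.2.2 - 0| < r := by
      rw [sub_zero]
      exact ((le_max_right _ _).trans (le_max_right _ _)).trans_lt h1
    rw [Set.indicator_of_mem (by exact h3), hh, Set.indicator_of_mem h2]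
    exact mul_le_mul_right (ENNReal.rpow_le_rpow (hB ξ) hτ.le) _
  · simp [image_eq_zero_of_notMem_tsupport hξ, ENNReal.zero_rpow_of_pos hτ]

theorem weightedIntegral_ne_top_of_disjoint_axis {b τ : ℝ} (hb : 0 ≤ b)
    (hτ : 0 < τ) {f : Heisenberg n → ℝ} (hf : Continuous f) (hc : HasCompactSupport f)
    (hd : Disjoint (tsupport f) (axis n)) : weightedIntegral b τ f ≠ ∞ := by
  obtain ⟨B, hB⟩ := exists_enorm_le hf hc
  have hpos : ∀ ξ ∈ tsupport f, 0 < horNorm ξ := fun ξ hξ => by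
    refine (horNorm_nonneg ξ).lt_of_ne fun h => Set.disjoint_left.1 hd hξ ?_
    have := planeNorm_eq_zero.1 ((horNorm_eq ξ).symm.trans h.symm)
    exact ⟨congrArg Prod.fst this, congrArg Prod.snd this⟩
  obtain ⟨δ, hδ, hδf⟩ : ∃ δ : ℝ, 0 < δ ∧ ∀ ξ ∈ tsupport f, δ ≤ horNorm ξ := by
    rcases (tsupport f).eq_empty_or_nonempty with he | hne
    · exact ⟨1, one_pos, by simp [he]⟩
    · obtain ⟨ξ₀, h0, hmin⟩ := hc.isCompact.exists_isMinOn hne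
        (continuous_horNorm (n := n)).continuousOn
      exact ⟨_, hpos ξ₀ h0, fun ξ hξ => hmin hξ⟩
  have hconst : ENNReal.ofReal δ ^ (-b) * (B : ℝ≥0∞) ^ τ ≠ ∞ :=
    ENNReal.mul_ne_top (by rw [ENNReal.ofReal_rpow_of_pos hδ]; exact ENNReal.ofReal_ne_top)
      (ENNReal.rpow_ne_top_of_nonneg hτ.le ENNReal.coe_ne_top)
  have hfin : ∫⁻ _ in tsupport f, ENNReal.ofReal δ ^ (-b) * (B : ℝ≥0∞) ^ τ ≠ ∞ := by
    rw [setLIntegral_const]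
    exact ENNReal.mul_ne_top hconst hc.isCompact.measure_lt_top.ne
  refine ne_top_of_le_ne_top hfin ?_
  rw [← lintegral_indicator (isClosed_tsupport f).measurableSet]
  refine lintegral_mono fun ξ => ?_
  by_cases hξ : ξ ∈ tsupport f
  · rw [Set.indicator_of_mem hξ]
    exact mul_le_mul' (rpow_neg_le_rpow_neg (ENNReal.ofReal_le_ofReal (hδf ξ hξ)) hb)
      (ENNReal.rpow_le_rpow (hB ξ) hτ.le)
  · simp [image_eq_zero_of_notMem_tsupport hξ, ENNReal.zero_rpow_of_pos hτ]

/-- Since `γ ≤ 0` and `d(ξ) ≥ |z|`, the gauge in the weight may be replaced by `|z|`. -/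
theorem weightedNorm_le (hn : 1 ≤ n) {s p α τ γ : ℝ} (hτ : 0 < τ) (hγ : γ ≤ 0)
    (f : Heisenberg n → ℝ) :
    weightedNorm s p α τ γ f
      ≤ weightedIntegral (-(τ * γ * (1 + (p - 2) * (α / (p * s))))) τ f ^ (1 / τ) := by
  refine ENNReal.rpow_le_rpow (lintegral_mono_ae ((ae_horNorm_pos hn).mono fun ξ hξ => ?_))
    (by positivity)
  have h1 : ENNReal.ofReal (gauge ξ) ^ (τ * γ) ≤ ENNReal.ofReal (horNorm ξ) ^ (τ * γ) := by
    have := rpow_neg_le_rpow_neg (ENNReal.ofReal_le_ofReal (horNorm_le_gauge ξ))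
      (b := -(τ * γ)) (by nlinarith)
    rwa [neg_neg] at this
  calc _ ≤ ENNReal.ofReal (horNorm ξ) ^ (τ * γ) *
        ENNReal.ofReal (horNorm ξ) ^ (τ * γ * (p - 2) * (α / (p * s))) * ‖f ξ‖ₑ ^ τ := by gcongr
    _ = _ := by
      rw [← ENNReal.rpow_add _ _ (by simpa using hξ) ENNReal.ofReal_ne_top]
      congr 2
      ring

end Heisenberg

theorem theorem1p1 (n : ℕ) (hn : 1 ≤ n) (p s α τ a γ q : ℝ)
    (hp : 1 < p) (hs₀ : 0 < s) (hs₁ : s < 1)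
    (hα₀ : 0 ≤ (p - 2) * α) (hα₁ : (p - 2) * α < Heisenberg.homDim n - 2)
    (hτ : 1 < τ) (ha₀ : 0 < a) (ha₁ : a ≤ 1)
    (hq₁ : 1 ≤ q) (hq : (1 - a) * τ < q)
    (hbal : 1 / τ + γ * (1 + (p - 2) * (α / (p * s))) / Heisenberg.homDim n
      = a * (1 / p - s * (1 + (p - 2) * (α / (p * s))) / Heisenberg.homDim n) + (1 - a) / q)
    (hγ₀ : 0 ≤ -γ) (hγ₁ : -γ ≤ a * s) :
    (2 / (τ * Heisenberg.homDim n)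
        < 1 / τ + γ * (1 + (p - 2) * (α / (p * s))) / Heisenberg.homDim n →
      ∃ C : ℝ≥0, ∀ f : Heisenberg n → ℝ, ContDiff ℝ 1 f → HasCompactSupport f →
        Heisenberg.weightedNorm s p α τ γ f
          ≤ C * Heisenberg.fracSeminorm s p α f ^ a
              * eLpNorm f (ENNReal.ofReal q) volume ^ (1 - a)) ∧
    (1 / τ + γ * (1 + (p - 2) * (α / (p * s))) / Heisenberg.homDim n
        < 2 / (τ * Heisenberg.homDim n) →
      ∃ C : ℝ≥0, ∀ f : Heisenberg n → ℝ, ContDiff ℝ 1 f → HasCompactSupport f →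
        Disjoint (tsupport f) (Heisenberg.axis n) →
        Heisenberg.weightedNorm s p α τ γ f
          ≤ C * Heisenberg.fracSeminorm s p α f ^ a
              * eLpNorm f (ENNReal.ofReal q) volume ^ (1 - a)) := by
  have hp₀ : 0 < p := by linarith
  have hτ₀ : 0 < τ := by linarith
  have hq₀ : 0 < q := by linarith
  have hQ : 0 < Heisenberg.homDim n := by unfold Heisenberg.homDim; positivity
  set κ := 1 + (p - 2) * (α / (p * s)) with hκ
  set b := -(τ * γ * κ) with hb
  have hκθ : s + (p - 2) * α / p = s * κ := by rw [hκ]; field_simp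
  have hκ₀ : 0 < κ := by
    have h : 0 ≤ (p - 2) * (α / (p * s)) := by rw [← mul_div_assoc]; positivity
    linarith
  have hb₀ : 0 ≤ b := by
    rw [hb, show -(τ * γ * κ) = τ * -γ * κ by ring]; positivity
  have hba : b ≤ a * τ * (s + (p - 2) * α / p) := by
    rw [hκθ, hb]
    have := mul_le_mul_of_nonneg_right hγ₁ (mul_pos hτ₀ hκ₀).le
    linarith
  have hlhs : 1 / τ + γ * κ / Heisenberg.homDim n
      = (Heisenberg.homDim n - b) / (τ * Heisenberg.homDim n) := by
    rw [hb]; field_simp; ring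
  have hbal' : 1 / τ - b / τ / Heisenberg.homDim n
      = a * (1 / p - (s + (p - 2) * α / p) / Heisenberg.homDim n) + (1 - a) / q := by
    rw [hκθ, ← hbal, hb]; field_simp; ring
  have main : b ≠ 2 * n → ∃ C : ℝ≥0, ∀ f : Heisenberg n → ℝ, ContDiff ℝ 1 f →
      Heisenberg.weightedIntegral b τ f ≠ ∞ →
        Heisenberg.weightedNorm s p α τ γ f
          ≤ C * Heisenberg.fracSeminorm s p α f ^ a
              * eLpNorm f (ENNReal.ofReal q) volume ^ (1 - a) := fun hbn => by
    obtain ⟨C, hC⟩ := Heisenberg.exists_weightedIntegral_rpow_le hn hp₀ hs₀ hα₀ hτ₀ hb₀ hbn ha₀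
      ha₁ hq₀ hba hbal'
    refine ⟨C, fun f hf hfin => ?_⟩
    rw [eLpNorm_eq_lintegral_rpow_enorm_toReal (by simpa using hq₀) ENNReal.ofReal_ne_top,
      ENNReal.toReal_ofReal hq₀.le]
    exact (Heisenberg.weightedNorm_le hn hτ₀ (by linarith) f).trans
      (hC f hf.continuous.measurable hfin)
  rw [hlhs, div_lt_div_iff_of_pos_right (by positivity),
    div_lt_div_iff_of_pos_right (by positivity), Heisenberg.homDim]
  refine ⟨fun h => ?_, fun h => ?_⟩
  · obtain ⟨C, hC⟩ := main (by intro; linarith)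
    exact ⟨C, fun f hf hc => hC f hf (Heisenberg.weightedIntegral_ne_top_of_lt hn hb₀
      (by linarith) hτ₀ hf.continuous hc)⟩
  · obtain ⟨C, hC⟩ := main (by intro; linarith)
    exact ⟨C, fun f hf hc hd => hC f hf (Heisenberg.weightedIntegral_ne_top_of_disjoint_axis hb₀
      hτ₀ hf.continuous hc hd)⟩
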